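/- **Definitions.** A Boolean circuit has gates $\wedge,\vee,\neg$ of fan-in at most two and constants; its size $|D|$ is the number of its gates. For distributions $X,Y$ on $\{0,1\}^n$ write $X\sim_{s,\epsilon}Y$ if $|\Pr[D(X)=1]-\Pr[D(Y)=1]|\le\epsilon$ for every Boolean circuit $D$ of size at most $s$. Let $\mathbf H_\infty(X)=-\log_2\max_x\Pr[X=x]$ be the min-entropy, and let $\mathbf H^{\mathrm{HILL}}_{s,\epsilon}(X)=\max\{\mathbf H_\infty(Y): Y \text{ on } \{0,1\}^n,\ Y\sim_{s,\epsilon}X\}$ be the HILL pseudoentropy of quality $(s,\epsilon)$. $U_m$ is the uniform distribution on $\{0,1\}^m$. **Theorem.** For every $c>0$ there is a constant $C>0$ (depending only on $c$) such that the following hold for all non-negative integers $n,k$. 1. For every function $f:\{0,1\}^k\to\{0,1\}^n$ and every $\epsilon$ with $c\,2^{-k/2}\le\epsilon\le\frac12$, $$\mathbf H^{\mathrm{HILL}}_{C n 2^k\epsilon^2,\ \epsilon}(f(U_k))\le k+1 .$$ 2. More generally, for every distribution $X$ on $\{0,1\}^n$ whose support has at most $2^k$ points and every $\epsilon$ with $c\,2^{-k/2}\le\epsilon\le\frac12$,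 $$\mathbf H^{\mathrm{HILL}}_{C n 2^k\epsilon^2,\ \epsilon}(X)\le k+1 .$$ 3. (Attack on pseudorandom generators, the case $n=k+1$.) For every $f:\{0,1\}^k\to\{0,1\}^{k+1}$ and every $\epsilon$ with $c\,2^{-k/2}\le\epsilon<\frac12$ there is a Boolean circuit $D$ of size at most $C(k+1)2^k\epsilon^2$ with $$\bigl|\Pr[D(f(U_k))=1]-\Pr[D(U_{k+1})=1]\bigr|>\epsilon .$$ -/

import Mathlib

namespace Pseudoentropy

noncomputable section

/-- A gate of a Boolean circuit over the basis `∧, ∨, ¬` (and the two constants), whose inputs are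
taken among `m` already available wires. -/
inductive Gate (m : ℕ) : Type
  | const (b : Bool) : Gate m
  | not (i : Fin m) : Gate m
  | and (i j : Fin m) : Gate m
  | or (i j : Fin m) : Gate m

/-- The value of a gate, given the values of the available wires. -/
def Gate.eval {m : ℕ} (v : Fin m → Bool) : Gate m → Bool
  | .const b => b
  | .not i => !(v i)
  | .and i j => v i && v j
  | .or i j => v i || v j

/-- `Gates n s`: a sequence of `s` gates on `n` input wires. The inputs of each gate are input wires
or outputs of earlier gates, with unbounded fan-out (an acyclic circuit, topologically ordered). -/
inductive Gates (n : ℕ) : ℕ → Type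
  | nil : Gates n 0
  | snoc {s : ℕ} (c : Gates n s) (g : Gate (n + s)) : Gates n (s + 1)

/-- The values of all wires: first the `n` inputs, then the `s` gates. -/
def Gates.wires {n : ℕ} (x : Fin n → Bool) : {s : ℕ} → Gates n s → Fin (n + s) → Bool
  | _, .nil => x
  | _, .snoc c g => Fin.snoc (α := fun _ => Bool) (c.wires x) (g.eval (c.wires x))

/-- A Boolean circuit with `n` inputs and one output; `size` is its number of gates. -/
structure Circuit (n : ℕ) : Type where
  size : ℕ
  gates : Gates n size
  out : Fin (n + size)

/-- The Boolean function computed by a circuit. -/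
def Circuit.eval {n : ℕ} (D : Circuit n) (x : Fin n → Bool) : Bool :=
  D.gates.wires x D.out

/-- `Pr[D(X) = 1]`. -/
def accProb {n : ℕ} (D : Circuit n) (X : PMF (Fin n → Bool)) : ℝ :=
  (X.map D.eval true).toReal

/-- `X ∼_{s,ε} Y`: no circuit of size at most `s` has distinguishing advantage above `ε`. -/
def Indist {n : ℕ} (s ε : ℝ) (X Y : PMF (Fin n → Bool)) : Prop :=
  ∀ D : Circuit n, (D.size : ℝ) ≤ s → |accProb D X - accProb D Y| ≤ ε

/-- Min-entropy `-log₂ max_x Pr[X = x]`. -/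
def minEntropy {n : ℕ} (X : PMF (Fin n → Bool)) : ℝ :=
  -Real.logb 2 (⨆ x, (X x).toReal)

/-- HILL pseudoentropy of quality `(s, ε)`: the largest min-entropy of a distribution `Y` on the
same cube with `Y ∼_{s,ε} X`. -/
def hill {n : ℕ} (s ε : ℝ) (X : PMF (Fin n → Bool)) : ℝ :=
  sSup {h : ℝ | ∃ Y : PMF (Fin n → Bool), Indist s ε Y X ∧ minEntropy Y = h}

/-- The uniform distribution `U_k` on `{0,1}^k`. -/
def unif (k : ℕ) : PMF (Fin k → Bool) :=
  PMF.uniformOfFintype (Fin k → Bool)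

/-- Min-entropy on `{0,1}^n` is at most `n`. -/
theorem minEntropy_le {n : ℕ} (X : PMF (Fin n → Bool)) : minEntropy X ≤ n := by
  have hs : ∑ x, (X x).toReal = 1 := by
    rw [← ENNReal.toReal_sum (fun x _ => X.apply_ne_top x), ← tsum_fintype (L := .unconditional _),
      X.tsum_coe, ENNReal.toReal_one]
  have hb : ∑ x, (X x).toReal ≤ (2 : ℝ) ^ n * ⨆ x, (X x).toReal := by
    calc ∑ x, (X x).toReal ≤ ∑ _x : Fin n → Bool, ⨆ x, (X x).toReal :=
          Finset.sum_le_sum fun x _ =>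
            le_ciSup (f := fun x => (X x).toReal) (Set.finite_range _).bddAbove x
      _ = _ := by simp
  rw [hs] at hb
  have h2 : (0 : ℝ) < 2 ^ n := by positivity
  have hM : ((2 : ℝ) ^ n)⁻¹ ≤ ⨆ x, (X x).toReal := by
    rw [inv_le_iff_one_le_mul₀ h2]; linarith
  have hl := Real.logb_le_logb_of_le (b := 2) (by norm_num) (inv_pos.mpr h2) hM
  rw [Real.logb_inv, Real.logb_pow, Real.logb_self_eq_one (by norm_num)] at hl
  unfold minEntropy
  linarith

/-- For `ε ≥ 0` the supremum in `hill` is over a nonempty set that is bounded above, so that it is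
a genuine supremum. -/
theorem hill_le_iff {n : ℕ} {s ε : ℝ} (hε : 0 ≤ ε) (X : PMF (Fin n → Bool)) (b : ℝ) :
    hill s ε X ≤ b ↔ ∀ Y : PMF (Fin n → Bool), Indist s ε Y X → minEntropy Y ≤ b := by
  unfold hill
  rw [csSup_le_iff]
  · constructor
    · intro h Y hY
      exact h _ ⟨Y, hY, rfl⟩
    · rintro h _ ⟨Y, hY, rfl⟩
      exact h Y hY
  · refine ⟨n, ?_⟩
    rintro _ ⟨Y, _, rfl⟩
    exact minEntropy_le Y
  · exact ⟨_, X, fun D _ => by simpa using hε, rfl⟩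

end

end Pseudoentropy

/-! Let `S` be the support of `X`, with at most `2 ^ k` points. A distribution `Y` of min-entropy
above `k + 1`, or uniform on `k + 1` bits, has mass at most `1 / 2` on `S`, so `g = X - Y` has `ℓ¹`
mass at least `1 / 2` there. A membership test for `S` distinguishes with `O(n 2^k)` gates, which
suffices when `ε` is bounded below. For smaller `ε`, cut `S` into about `2^k ε²` pieces of at most
`L ≈ 1 / (32 ε²)` points. By Parseval some signed parity correlates with `g` on a piece at least as
much as the `ℓ²` norm there, hence by Cauchy–Schwarz at least as much as the `ℓ¹` mass divided by
`√L`. Summing over the pieces gives advantage at least `1 / (4 √L) > ε` (`exists_correlation`). The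
pieces are cut out by tests of `O(n)` gates (`Computable.exists_card_filter`), so each piece costs
`O(n)` gates in total. -/

namespace Pseudoentropy

/-! ### Gate counts, and circuits that select a prescribed number of points -/

section Circuits

variable {n : ℕ}

/-- The function `F` is carried by one of the wires of `c`. -/
def Gates.Avail {s : ℕ} (c : Gates n s) (F : (Fin n → Bool) → Bool) : Prop :=
  ∃ i, ∀ x, c.wires x i = F x

/-- `c'` carries everything that `c` carries. -/
def Gates.Extends {s s' : ℕ} (c' : Gates n s') (c : Gates n s) : Prop :=
  ∀ G, c.Avail G → c'.Avail G

theorem Gates.extends_snoc {s : ℕ} (c : Gates n s) (g : Gate (n + s)) :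
    (c.snoc g).Extends c := by
  rintro G ⟨i, hi⟩
  refine ⟨Fin.castSucc i, fun x => ?_⟩
  rw [← hi x]
  exact Fin.snoc_castSucc (α := fun _ => Bool) _ _ i

theorem Gates.avail_snoc {s : ℕ} (c : Gates n s) (g : Gate (n + s)) :
    (c.snoc g).Avail fun x => g.eval (c.wires x) :=
  ⟨Fin.last (n + s), fun _ => Fin.snoc_last (α := fun _ => Bool) _ _⟩

theorem Gates.Avail.exists_not {s : ℕ} {c : Gates n s} {F : (Fin n → Bool) → Bool}
    (hF : c.Avail F) :
    ∃ c' : Gates n (s + 1), c'.Extends c ∧ c'.Avail fun x => !(F x) := by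
  obtain ⟨i, hi⟩ := hF
  refine ⟨c.snoc (.not i), c.extends_snoc _, ?_⟩
  simpa [Gate.eval, hi] using c.avail_snoc (.not i)

theorem Gates.Avail.exists_and {s : ℕ} {c : Gates n s} {F G : (Fin n → Bool) → Bool}
    (hF : c.Avail F) (hG : c.Avail G) :
    ∃ c' : Gates n (s + 1), c'.Extends c ∧ c'.Avail fun x => F x && G x := by
  obtain ⟨i, hi⟩ := hF
  obtain ⟨j, hj⟩ := hG
  refine ⟨c.snoc (.and i j), c.extends_snoc _, ?_⟩
  simpa [Gate.eval, hi, hj] using c.avail_snoc (.and i j)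

theorem Gates.Avail.exists_or {s : ℕ} {c : Gates n s} {F G : (Fin n → Bool) → Bool}
    (hF : c.Avail F) (hG : c.Avail G) :
    ∃ c' : Gates n (s + 1), c'.Extends c ∧ c'.Avail fun x => F x || G x := by
  obtain ⟨i, hi⟩ := hF
  obtain ⟨j, hj⟩ := hG
  refine ⟨c.snoc (.or i j), c.extends_snoc _, ?_⟩
  simpa [Gate.eval, hi, hj] using c.avail_snoc (.or i j)

/-- `F` can be computed with `t` gates, in the form that every sequence of gates can be prolonged
by at most `t` gates so as to carry `F`. -/
def Computable (t : ℕ) (F : (Fin n → Bool) → Bool) : Prop :=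
  ∀ (s : ℕ) (c : Gates n s), ∃ s' ≤ s + t, ∃ c' : Gates n s', c'.Extends c ∧ c'.Avail F

namespace Computable

variable {a b : ℕ} {F G : (Fin n → Bool) → Bool}

theorem exists_circuit (h : Computable a F) : ∃ D : Circuit n, D.size ≤ a ∧ D.eval = F := by
  obtain ⟨s, hs, c, -, i, hi⟩ := h 0 .nil
  exact ⟨⟨s, c, i⟩, by simpa using hs, funext hi⟩

theorem mono (h : Computable a F) (hab : a ≤ b) : Computable b F := fun s c => by
  obtain ⟨s', hs', h'⟩ := h s c
  exact ⟨s', by omega, h'⟩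

theorem const (v : Bool) : Computable (n := n) 1 fun _ => v := fun s c =>
  ⟨s + 1, le_rfl, c.snoc (.const v), c.extends_snoc _, by
    simpa [Gate.eval] using c.avail_snoc (.const v)⟩

theorem input (i : Fin n) : Computable 0 fun x => x i := fun s c => by
  refine ⟨s, le_rfl, c, fun _ h => h, ?_⟩
  induction c with
  | nil => exact ⟨i, fun _ => rfl⟩
  | snoc c g ih => exact c.extends_snoc g _ ih

theorem not (h : Computable a F) : Computable (a + 1) fun x => !(F x) := fun s c => by
  obtain ⟨s₁, hs₁, c₁, e₁, hF⟩ := h s c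
  obtain ⟨c₂, e₂, h₂⟩ := hF.exists_not
  exact ⟨s₁ + 1, by omega, c₂, fun _ h => e₂ _ (e₁ _ h), h₂⟩

theorem and (hF : Computable a F) (hG : Computable b G) :
    Computable (a + b + 1) fun x => F x && G x := fun s c => by
  obtain ⟨s₁, hs₁, c₁, e₁, h₁⟩ := hF s c
  obtain ⟨s₂, hs₂, c₂, e₂, h₂⟩ := hG s₁ c₁
  obtain ⟨c₃, e₃, h₃⟩ := (e₂ _ h₁).exists_and h₂
  exact ⟨s₂ + 1, by omega, c₃, fun _ h => e₃ _ (e₂ _ (e₁ _ h)), h₃⟩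

theorem or (hF : Computable a F) (hG : Computable b G) :
    Computable (a + b + 1) fun x => F x || G x := fun s c => by
  obtain ⟨s₁, hs₁, c₁, e₁, h₁⟩ := hF s c
  obtain ⟨s₂, hs₂, c₂, e₂, h₂⟩ := hG s₁ c₁
  obtain ⟨c₃, e₃, h₃⟩ := (e₂ _ h₁).exists_or h₂
  exact ⟨s₂ + 1, by omega, c₃, fun _ h => e₃ _ (e₂ _ (e₁ _ h)), h₃⟩

theorem xor (hF : Computable a F) (hG : Computable b G) :
    Computable (a + b + 4) fun x => F x ^^ G x := fun s c => by
  obtain ⟨s₁, hs₁, c₁, e₁, h₁⟩ := hF s c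
  obtain ⟨s₂, hs₂, c₂, e₂, h₂⟩ := hG s₁ c₁
  obtain ⟨c₃, e₃, h₃⟩ := (e₂ _ h₁).exists_or h₂
  obtain ⟨c₄, e₄, h₄⟩ := (e₃ _ (e₂ _ h₁)).exists_and (e₃ _ h₂)
  obtain ⟨c₅, e₅, h₅⟩ := h₄.exists_not
  obtain ⟨c₆, e₆, h₆⟩ := (e₅ _ (e₄ _ h₃)).exists_and h₅
  refine ⟨_, by omega, c₆, fun _ h => e₆ _ (e₅ _ (e₄ _ (e₃ _ (e₂ _ (e₁ _ h))))), ?_⟩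
  convert h₆ using 2 with x
  cases F x <;> cases G x <;> rfl

theorem cond {p : ℕ} {P : (Fin n → Bool) → Bool} (hP : Computable p P) (hF : Computable a F)
    (hG : Computable b G) :
    Computable (2 * p + a + b + 4) fun x => bif P x then F x else G x := by
  -- `P` is built twice instead of sharing its wire, whence `2 * p`.
  have h := (hP.and hF).or (hP.not.and hG)
  refine (show (fun x => bif P x then F x else G x) = _ from ?_) ▸ h.mono (by omega)
  funext x
  cases P x <;> simp

/-- Membership in a finite set, as a disjunction of minterms. -/
theorem mem_finset (S : Finset (Fin n → Bool)) :
    Computable ((2 * n + 2) * S.card + 1) fun x => decide (x ∈ S) := by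
  classical
  have minterm (y : Fin n → Bool) (J : Finset (Fin n)) :
      Computable (2 * J.card + 1) fun x => decide (∀ i ∈ J, x i = y i) := by
    induction J using Finset.induction_on with
    | empty => simpa using const (n := n) true
    | insert i J hi ih =>
      have hl : Computable 1 fun x : Fin n → Bool => decide (x i = y i) := by
        cases y i
        · simpa using (input i).not
        · simpa using (input i).mono zero_le_one
      have h := hl.and ih
      rw [Finset.card_insert_of_notMem hi]
      simpa using h.mono (show 1 + (2 * J.card + 1) + 1 ≤ 2 * (J.card + 1) + 1 by omega)
  induction S using Finset.induction_on with
  | empty => simpa using const (n := n) false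
  | insert y S hy ih =>
    have h := (minterm y Finset.univ).or ih
    rw [Finset.card_insert_of_notMem hy]
    simpa [funext_iff] using h.mono (show _ ≤ (2 * n + 2) * (S.card + 1) + 1 by
      simp only [Finset.card_univ, Fintype.card_fin]; ring_nf; omega)

/-- Some small circuit accepts exactly `L` points of a given set. -/
theorem exists_card_filter (J : Finset (Fin n)) (S : Finset (Fin n → Bool))
    (hS : ∀ x ∈ S, ∀ y ∈ S, (∀ i ∈ J, x i = y i) → x = y) (L : ℕ) (hL : L ≤ S.card) :
    ∃ P : (Fin n → Bool) → Bool, Computable (2 * J.card + 1) P ∧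
      (S.filter fun x => P x = true).card = L := by
  classical
  induction J using Finset.induction_on generalizing S L with
  | empty =>
    have h1 : S.card ≤ 1 := Finset.card_le_one.2 fun x hx y hy => hS x hx y hy (by simp)
    rcases Nat.eq_zero_or_pos L with rfl | h
    · exact ⟨fun _ => false, const _, by simp⟩
    · exact ⟨fun _ => true, const _, by simp; omega⟩
  | insert i J hi ih =>
    have split (v : Bool) : ∀ x ∈ S.filter (fun x => x i = v), ∀ y ∈ S.filter (fun x => x i = v),
        (∀ j ∈ J, x j = y j) → x = y := by
      intro x hx y hy h
      simp only [Finset.mem_filter] at hx hy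
      refine hS x hx.1 y hy.1 fun j hj => ?_
      rcases Finset.mem_insert.1 hj with rfl | hj
      · rw [hx.2, hy.2]
      · exact h j hj
    have hsum : (S.filter fun x => x i = false).card + (S.filter fun x => x i = true).card
        = S.card := by
      rw [← Finset.card_filter_add_card_filter_not (s := S) (fun x => x i = false)]
      simp
    rw [Finset.card_insert_of_notMem hi]
    -- Accept an initial segment of `S` in a lexicographic order: if the half `x i = false` has
    -- enough points, reject the other half and recurse; otherwise accept that half whole and look
    -- for the remainder in the other.
    by_cases h : L ≤ (S.filter fun x => x i = false).card
    · obtain ⟨P, hP, hc⟩ := ih _ (split false) L h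
      refine ⟨fun x => !(x i) && P x, ((input i).not.and hP).mono (by omega), ?_⟩
      rw [← hc, Finset.filter_filter]
      simp
    · obtain ⟨P, hP, hc⟩ := ih _ (split true) (L - (S.filter fun x => x i = false).card)
        (by omega)
      refine ⟨fun x => !(x i) || P x, ((input i).not.or hP).mono (by omega), ?_⟩
      have hd : (S.filter fun x => (!(x i) || P x) = true) = (S.filter fun x => x i = false) ∪
          (S.filter fun x => x i = true).filter fun x => P x = true := by
        ext x
        simp only [Finset.mem_filter, Finset.mem_union]
        cases x i <;> simp
      rw [hd, Finset.card_union_of_disjoint, hc]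
      · omega
      · rw [Finset.disjoint_left]
        intro x hx hx'
        simp only [Finset.mem_filter] at hx hx'
        simp_all

end Computable

end Circuits

/-! ### Fourier analysis on the cube, and correlation with parities -/

section Parity

variable {n : ℕ}

/-- The sign `1` for `true` and `-1` for `false`. -/
def sgn (v : Bool) : ℝ := bif v then 1 else -1

theorem sgn_not (v : Bool) : sgn (!v) = -sgn v := by cases v <;> simp [sgn]

theorem sgn_sq (v : Bool) : sgn v * sgn v = 1 := by cases v <;> simp [sgn]

theorem sgn_not_xor (v w : Bool) : sgn (!(v ^^ w)) = sgn v * sgn w := by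
  cases v <;> cases w <;> simp [sgn]

/-- The characters of the cube `{0,1}^n`. -/
def chi (a x : Fin n → Bool) : ℝ := ∏ i, bif a i then sgn (x i) else 1

theorem sum_chi_mul_chi (x y : Fin n → Bool) :
    ∑ a, chi a x * chi a y = if x = y then (2 : ℝ) ^ n else 0 := by
  have h : ∑ a, chi a x * chi a y
      = ∏ i, ∑ v : Bool, (bif v then sgn (x i) * sgn (y i) else 1) := by
    rw [Finset.prod_univ_sum, Fintype.piFinset_univ]
    refine Finset.sum_congr rfl fun a _ => ?_
    rw [chi, chi, ← Finset.prod_mul_distrib]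
    refine Finset.prod_congr rfl fun i _ => ?_
    cases a i <;> simp
  rw [h]
  split_ifs with hxy
  · subst hxy
    simp [sgn_sq]
  · obtain ⟨i, hi⟩ := Function.ne_iff.1 hxy
    refine Finset.prod_eq_zero (Finset.mem_univ i) ?_
    revert hi
    cases x i <;> cases y i <;> simp [sgn]

/-- Parseval's identity on the cube. -/
theorem sum_sq_fourier (g : (Fin n → Bool) → ℝ) :
    ∑ a, (∑ x, g x * chi a x) ^ 2 = 2 ^ n * ∑ x, g x ^ 2 := by
  calc ∑ a, (∑ x, g x * chi a x) ^ 2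
      = ∑ a, ∑ x, ∑ y, g x * g y * (chi a x * chi a y) := by
        refine Finset.sum_congr rfl fun a _ => ?_
        rw [sq, Finset.sum_mul_sum]
        refine Finset.sum_congr rfl fun x _ => Finset.sum_congr rfl fun y _ => by ring
    _ = ∑ x, ∑ y, g x * g y * ∑ a, chi a x * chi a y := by
        rw [Finset.sum_comm]
        refine Finset.sum_congr rfl fun x _ => ?_
        rw [Finset.sum_comm]
        simp only [Finset.mul_sum]
    _ = 2 ^ n * ∑ x, g x ^ 2 := by
        simp only [sum_chi_mul_chi, mul_ite, mul_zero, Finset.sum_ite_eq, Finset.mem_univ, if_true]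
        rw [Finset.mul_sum]
        exact Finset.sum_congr rfl fun x _ => by ring

theorem exists_computable_chi (a : Fin n → Bool) :
    ∃ F : (Fin n → Bool) → Bool, Computable (5 * n + 1) F ∧ ∀ x, sgn (F x) = chi a x := by
  classical
  have key (J : Finset (Fin n)) : ∃ F : (Fin n → Bool) → Bool, Computable (5 * J.card + 1) F ∧
      ∀ x, sgn (F x) = ∏ i ∈ J, bif a i then sgn (x i) else 1 := by
    induction J using Finset.induction_on with
    | empty => exact ⟨fun _ => true, Computable.const _, by simp [sgn]⟩
    | insert i J hi ih =>
      obtain ⟨F, hF, h⟩ := ih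
      rw [Finset.card_insert_of_notMem hi]
      simp only [Finset.prod_insert hi, ← h]
      cases a i
      · exact ⟨F, hF.mono (by omega), by simp⟩
      -- As `true` has sign `1`, the product of signs is XNOR: four gates for the XOR and one for
      -- the negation.
      · refine ⟨fun x => !(x i ^^ F x), ((Computable.input i).xor hF).not.mono (by omega),
          fun x => by simp [sgn_not_xor]⟩
  simpa [chi] using key Finset.univ

/-- Up to sign, some parity correlates with `g` at least as much as the `ℓ²` norm of `g`. -/
theorem exists_parity_correlation (g : (Fin n → Bool) → ℝ) :
    ∃ F : (Fin n → Bool) → Bool, Computable (5 * n + 2) F ∧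
      √(∑ x, g x ^ 2) ≤ ∑ x, g x * sgn (F x) := by
  -- By Parseval the squared coefficients average to `∑ x, g x ^ 2` over the `2 ^ n` characters, so
  -- one of them reaches the average.
  obtain ⟨a, ha⟩ : ∃ a, ∑ x, g x ^ 2 ≤ (∑ x, g x * chi a x) ^ 2 := by
    by_contra! h
    have := Finset.sum_lt_sum_of_nonempty (Finset.univ_nonempty (α := Fin n → Bool))
      fun a _ => h a
    rw [sum_sq_fourier] at this
    simp at this
  obtain ⟨F, hF, hs⟩ := exists_computable_chi a
  simp only [← hs] at ha
  have hr := Real.sqrt_le_sqrt ha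
  rw [Real.sqrt_sq_eq_abs] at hr
  rcases le_total 0 (∑ x, g x * sgn (F x)) with h | h
  · exact ⟨F, hF.mono (by omega), by rwa [abs_of_nonneg h] at hr⟩
  · refine ⟨fun x => !(F x), hF.not, ?_⟩
    rw [abs_of_nonpos h] at hr
    simpa [sgn_not] using hr

/-- Correlation with the `ℓ¹` mass of a set of at most `q * L` points: cut the set into `q` parts of
at most `L` points by small circuits, and use a parity on every part. -/
theorem exists_correlation {L : ℕ} (q : ℕ) (g : (Fin n → Bool) → ℝ)
    (S : Finset (Fin n → Bool)) (hS : S.card ≤ q * L) :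
    ∃ F : (Fin n → Bool) → Bool, Computable ((9 * n + 8) * q + 1) F ∧
      (∑ x ∈ S, |g x|) / √L ≤ ∑ x, g x * sgn (F x) := by
  classical
  induction q generalizing g S with
  | zero =>
    have hS0 : S = ∅ := by simpa using hS
    subst hS0
    -- With no piece left, a constant of the right sign keeps the correlation nonnegative.
    rcases le_total 0 (∑ x, g x) with h | h
    · exact ⟨fun _ => true, Computable.const _, by simpa [sgn] using h⟩
    · exact ⟨fun _ => false, Computable.const _, by simpa [sgn] using h⟩
  | succ q ih =>
    obtain ⟨P, hP, hc⟩ := Computable.exists_card_filter Finset.univ S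
      (fun x _ y _ h => funext fun i => h i (Finset.mem_univ i)) (min L S.card) (min_le_right _ _)
    rw [Finset.card_univ, Fintype.card_fin] at hP
    have hadd := Finset.card_filter_add_card_filter_not (s := S) (fun x => P x = true)
    have hcard : (S.filter fun x => ¬ P x = true).card ≤ q * L := by
      rw [add_mul, one_mul] at hS
      omega
    -- Zeroing `g` where `P` holds, and outside `P` for the parity, makes the two correlations add
    -- exactly, with no interference between cells.
    obtain ⟨G, hG, hGc⟩ := ih (fun x => bif P x then 0 else g x) _ hcard
    obtain ⟨H, hH, hHc⟩ := exists_parity_correlation fun x => bif P x then g x else 0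
    refine ⟨fun x => bif P x then H x else G x, (hP.cond hH hG).mono (by ring_nf; omega), ?_⟩
    have e : ∑ x, g x * sgn (bif P x then H x else G x)
        = ∑ x, (bif P x then g x else 0) * sgn (H x)
          + ∑ x, (bif P x then 0 else g x) * sgn (G x) := by
      rw [← Finset.sum_add_distrib]
      refine Finset.sum_congr rfl fun x _ => ?_
      cases P x <;> simp
    have eS : ∑ x ∈ S, |g x| = ∑ x ∈ S.filter (fun x => P x = true), |g x|
        + ∑ x ∈ S.filter (fun x => ¬ P x = true), |bif P x then 0 else g x| := by
      rw [← Finset.sum_filter_add_sum_filter_not S (fun x => P x = true)]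
      congr 1
      refine Finset.sum_congr rfl fun x hx => ?_
      simp [Bool.eq_false_of_not_eq_true (Finset.mem_filter.1 hx).2]
    rw [e, eS, add_div]
    refine add_le_add (le_trans ?_ hHc) hGc
    set T := S.filter fun x => P x = true
    have hT : (T.card : ℝ) ≤ L := by exact_mod_cast hc.le.trans (min_le_left _ _)
    -- The cell of `P` may contain points outside `S`; they only increase the `ℓ²` norm.
    have hcs : (∑ x ∈ T, |g x|) ^ 2 ≤ L * ∑ x, (bif P x then g x else 0) ^ 2 := by
      calc (∑ x ∈ T, |g x|) ^ 2 ≤ T.card * ∑ x ∈ T, |g x| ^ 2 := sq_sum_le_card_mul_sum_sq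
        _ = T.card * ∑ x ∈ T, (bif P x then g x else 0) ^ 2 := by
            congr 1
            refine Finset.sum_congr rfl fun x hx => ?_
            simp [(Finset.mem_filter.1 hx).2]
        _ ≤ _ := mul_le_mul hT (Finset.sum_le_univ_sum_of_nonneg fun x => sq_nonneg _)
            (Finset.sum_nonneg fun x _ => sq_nonneg _) (Nat.cast_nonneg _)
    refine div_le_of_le_mul₀ (Real.sqrt_nonneg _) (Real.sqrt_nonneg _) ?_
    rw [← Real.sqrt_mul (Finset.sum_nonneg fun x _ => sq_nonneg _), mul_comm]
    exact Real.le_sqrt_of_sq_le hcs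

end Parity

/-! ### From correlation to distinguishers and pseudoentropy bounds -/

section Distinguishers

variable {n : ℕ}

theorem sum_toReal (X : PMF (Fin n → Bool)) : ∑ x, (X x).toReal = 1 := by
  rw [← ENNReal.toReal_sum fun x _ => X.apply_ne_top x, ← tsum_fintype (L := .unconditional _),
    X.tsum_coe, ENNReal.toReal_one]

open Classical in
theorem sum_support_toReal (X : PMF (Fin n → Bool)) :
    ∑ x ∈ X.support.toFinset, (X x).toReal = 1 := by
  rw [← sum_toReal X]
  refine Finset.sum_subset (Finset.subset_univ _) fun x _ hx => ?_
  simp only [Set.mem_toFinset, PMF.mem_support_iff, not_not] at hx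
  simp [hx]

theorem accProb_eq_sum (D : Circuit n) (X : PMF (Fin n → Bool)) :
    accProb D X = ∑ x, if D.eval x = true then (X x).toReal else 0 := by
  rw [accProb, PMF.map_apply, tsum_fintype, ENNReal.toReal_sum]
  · refine Finset.sum_congr rfl fun x _ => ?_
    by_cases h : D.eval x = true <;> simp [h]
  · intro x _
    split_ifs
    · exact X.apply_ne_top x
    · simp

/-- The sign is twice the indicator of acceptance minus one, and the `-1` drops out because `X - Y`
has total mass zero. -/
theorem accProb_sub_eq (D : Circuit n) (X Y : PMF (Fin n → Bool)) :
    ∑ x, ((X x).toReal - (Y x).toReal) * sgn (D.eval x) = 2 * (accProb D X - accProb D Y) := by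
  have h : ∑ x, ((X x).toReal - (Y x).toReal) = 0 := by
    rw [Finset.sum_sub_distrib, sum_toReal, sum_toReal, sub_self]
  rw [accProb_eq_sum, accProb_eq_sum, ← Finset.sum_sub_distrib, Finset.mul_sum, ← sub_eq_zero,
    ← neg_eq_zero, ← h, ← Finset.sum_sub_distrib, ← Finset.sum_neg_distrib]
  refine Finset.sum_congr rfl fun x _ => ?_
  cases D.eval x <;> simp [sgn]
  ring

/-- The constant in the size of the distinguishers. -/
noncomputable def sizeConst (c : ℝ) : ℝ := 18 * (64 + 1 / c ^ 2)

theorem sizeConst_pos {c : ℝ} (hc : 0 < c) : 0 < sizeConst c := by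
  unfold sizeConst
  positivity

theorem exists_distinguisher_of_large {S : Finset (Fin n → Bool)} {X Y : PMF (Fin n → Bool)}
    (hX : ∑ x ∈ S, (X x).toReal = 1) {ε : ℝ} (hY : ε < 1 - ∑ x ∈ S, (Y x).toReal) :
    ∃ D : Circuit n, D.size ≤ (2 * n + 2) * S.card + 1 ∧ ε < accProb D X - accProb D Y := by
  classical
  obtain ⟨D, hD, he⟩ := (Computable.mem_finset S).exists_circuit
  refine ⟨D, hD, ?_⟩
  simpa [accProb_eq_sum, he, hX] using hY

/-- The `1 / 4` is the `ℓ¹` mass `1 / 2` on `S`, halved again in passing from sign correlation to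
acceptance probabilities. -/
theorem exists_distinguisher_of_small {S : Finset (Fin n → Bool)} {X Y : PMF (Fin n → Bool)}
    (hX : ∑ x ∈ S, (X x).toReal = 1) (hY : ∑ x ∈ S, (Y x).toReal ≤ 1 / 2) {q L : ℕ}
    (hS : S.card ≤ q * L) :
    ∃ D : Circuit n, D.size ≤ (9 * n + 8) * q + 1 ∧
      1 / (4 * √L) ≤ accProb D X - accProb D Y := by
  obtain ⟨F, hF, h⟩ := exists_correlation q (fun x => (X x).toReal - (Y x).toReal) S hS
  obtain ⟨D, hD, rfl⟩ := hF.exists_circuit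
  refine ⟨D, hD, ?_⟩
  rw [accProb_sub_eq] at h
  have h1 : 1 / 2 ≤ ∑ x ∈ S, |(X x).toReal - (Y x).toReal| := by
    calc (1 / 2 : ℝ) ≤ ∑ x ∈ S, ((X x).toReal - (Y x).toReal) := by
          rw [Finset.sum_sub_distrib]; linarith
      _ ≤ _ := Finset.sum_le_sum fun x _ => le_abs_self _
  have h2 := (div_le_div_of_nonneg_right h1 (Real.sqrt_nonneg L)).trans h
  have h3 : 1 / (4 * √(L : ℝ)) = 1 / 2 / √L / 2 := by rw [div_div, div_div]; ring_nf
  rw [h3]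
  linarith

theorem exists_distinguisher {c ε : ℝ} (hc : 0 < c) {k : ℕ} (hn : 1 ≤ n)
    {S : Finset (Fin n → Bool)} (hS : S.card ≤ 2 ^ k) {X Y : PMF (Fin n → Bool)}
    (hX : ∑ x ∈ S, (X x).toReal = 1) (hY : ∑ x ∈ S, (Y x).toReal ≤ 1 / 2)
    (hε : c * (2 : ℝ) ^ (-(k : ℝ) / 2) ≤ ε) (hYε : ε < 1 - ∑ x ∈ S, (Y x).toReal) :
    ∃ D : Circuit n, (D.size : ℝ) ≤ sizeConst c * n * (2 ^ k * ε ^ 2) ∧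
      ε < accProb D X - accProb D Y := by
  have hε0 : 0 < ε := lt_of_lt_of_le (by positivity) hε
  have hn' : (1 : ℝ) ≤ n := by exact_mod_cast hn
  have h2k : (1 : ℝ) ≤ 2 ^ k := one_le_pow₀ (by norm_num)
  have hc2 : c ^ 2 ≤ 2 ^ k * ε ^ 2 := by
    have h := pow_le_pow_left₀ (by positivity) hε 2
    have e : ((2 : ℝ) ^ (-(k : ℝ) / 2)) ^ 2 = (2 ^ k)⁻¹ := by
      rw [← Real.rpow_natCast, ← Real.rpow_mul (by norm_num), ← Real.rpow_natCast 2 k,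
        ← Real.rpow_neg (by norm_num)]
      congr 1
      push_cast
      ring
    rw [mul_pow, e, ← div_eq_mul_inv, div_le_iff₀ (by positivity)] at h
    linarith
  -- The threshold is where `1 / (32 ε²)` drops below `1`, so that no piece size `L ≥ 1` would be
  -- available.
  by_cases hlarge : 1 / 32 < ε ^ 2
  · obtain ⟨D, hD, h⟩ := exists_distinguisher_of_large hX hYε
    refine ⟨D, ?_, h⟩
    have hS' : (S.card : ℝ) ≤ 2 ^ k := by exact_mod_cast hS
    calc (D.size : ℝ) ≤ (2 * n + 2) * S.card + 1 := by exact_mod_cast hD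
      _ ≤ (4 * n) * 2 ^ k + n * 2 ^ k := by
          gcongr
          · linarith
          · nlinarith
      _ = 5 * 32 * n * (2 ^ k * (1 / 32)) := by ring
      _ ≤ sizeConst c * n * (2 ^ k * ε ^ 2) := by
          have : 0 < 1 / c ^ 2 := by positivity
          have := sizeConst_pos hc
          gcongr
          unfold sizeConst
          linarith
  · push Not at hlarge
    -- With `L ≤ r` the advantage `1 / (4 √L)` is at least `√2 ε`, hence strictly above `ε`.
    -- Rounding down at most halves `r`, which turns `32` into the `64` of `sizeConst`.
    set r : ℝ := 1 / (32 * ε ^ 2) with hr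
    have hr1 : 1 ≤ r := by
      rw [hr, le_div_iff₀ (by positivity)]
      linarith
    have hfl : (⌊r⌋₊ : ℝ) ≤ r := Nat.floor_le (by linarith)
    have hfl1 : (1 : ℝ) ≤ ⌊r⌋₊ := by exact_mod_cast Nat.one_le_floor_iff r |>.2 hr1
    have hfl2 : r / 2 ≤ ⌊r⌋₊ := by linarith [Nat.lt_floor_add_one r]
    set L := ⌊r⌋₊
    set q := ⌈(2 : ℝ) ^ k / L⌉₊ with hq
    have hqL : S.card ≤ q * L := by
      have h := Nat.le_ceil ((2 : ℝ) ^ k / L)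
      rw [div_le_iff₀ (by linarith)] at h
      have h' : 2 ^ k ≤ q * L := by
        rw [← hq] at h
        exact_mod_cast h
      exact hS.trans h'
    have hqle : (q : ℝ) ≤ (64 + 1 / c ^ 2) * (2 ^ k * ε ^ 2) := by
      have h1 : (q : ℝ) ≤ 2 ^ k / L + 1 := (Nat.ceil_lt_add_one (by positivity)).le
      have h2 : (2 : ℝ) ^ k / L ≤ 2 ^ k / (r / 2) := by gcongr
      have h3 : (2 : ℝ) ^ k / (r / 2) = 64 * (2 ^ k * ε ^ 2) := by
        rw [hr]; field_simp; norm_num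
      -- The lower bound on `ε` absorbs the `+ 1` from rounding up the number of pieces; this is the
      -- source of `1 / c ^ 2`.
      have h4 : 1 ≤ 1 / c ^ 2 * (2 ^ k * ε ^ 2) := by
        rw [div_mul_eq_mul_div, one_mul, le_div_iff₀ (by positivity)]
        linarith
      linarith
    have hq1 : (1 : ℝ) ≤ q := by
      exact_mod_cast Nat.one_le_ceil_iff.2 (by positivity)
    obtain ⟨D, hD, h⟩ := exists_distinguisher_of_small hX hY hqL
    refine ⟨D, ?_, lt_of_lt_of_le ?_ h⟩
    · calc (D.size : ℝ) ≤ (9 * n + 8) * q + 1 := by exact_mod_cast hD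
        _ ≤ 18 * n * q := by nlinarith
        _ ≤ 18 * n * ((64 + 1 / c ^ 2) * (2 ^ k * ε ^ 2)) := by gcongr
        _ = _ := by unfold sizeConst; ring
    · have hLpos : 0 < √(L : ℝ) := Real.sqrt_pos.2 (by linarith)
      rw [lt_div_iff₀ (by positivity)]
      refine lt_of_pow_lt_pow_left₀ 2 zero_le_one ?_
      rw [mul_pow, mul_pow, Real.sq_sqrt (by linarith)]
      have h5 : ε ^ 2 * r = 1 / 32 := by rw [hr]; field_simp
      nlinarith [sq_nonneg ε]

theorem toReal_lt_of_lt_minEntropy {k : ℕ} {Y : PMF (Fin n → Bool)}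
    (h : (k : ℝ) + 1 < minEntropy Y) (x : Fin n → Bool) :
    (Y x).toReal < ((2 : ℝ) ^ (k + 1))⁻¹ := by
  have hle : (Y x).toReal ≤ ⨆ x, (Y x).toReal :=
    le_ciSup (f := fun x => (Y x).toReal) (Set.finite_range _).bddAbove x
  refine hle.trans_lt ?_
  unfold minEntropy at h
  rcases (Real.iSup_nonneg fun x => ENNReal.toReal_nonneg : 0 ≤ ⨆ x, (Y x).toReal).eq_or_lt
    with h0 | h0
  · rw [← h0]; positivity
  · have h' : Real.logb 2 (⨆ x, (Y x).toReal) < -((k : ℝ) + 1) := by linarith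
    rw [Real.logb_lt_iff_lt_rpow (by norm_num) h0, Real.rpow_neg (by norm_num)] at h'
    exact_mod_cast h'

theorem hill_le_of_card_support {c : ℝ} (hc : 0 < c) {k : ℕ} {X : PMF (Fin n → Bool)}
    (hX : X.support.ncard ≤ 2 ^ k) {ε : ℝ} (hε : c * (2 : ℝ) ^ (-(k : ℝ) / 2) ≤ ε)
    (hε' : ε ≤ 1 / 2) :
    hill (sizeConst c * n * (2 ^ k * ε ^ 2)) ε X ≤ (k : ℝ) + 1 := by
  classical
  have hε0 : 0 < ε := lt_of_lt_of_le (by positivity) hε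
  rw [hill_le_iff hε0.le]
  intro Y hY
  by_contra! hlt
  -- For `n = 0` the size budget vanishes, but then no `Y` has min-entropy above `k + 1`.
  have hn : 1 ≤ n := by
    have h := hlt.trans_le (minEntropy_le Y)
    have : k + 1 < n := by exact_mod_cast h
    omega
  set S := X.support.toFinset with hSdef
  have hS : S.card ≤ 2 ^ k := by rwa [hSdef, ← Set.ncard_eq_toFinset_card']
  have hXS : ∑ x ∈ S, (X x).toReal = 1 := sum_support_toReal X
  have hSne : S.Nonempty := by
    rw [Finset.nonempty_iff_ne_empty]
    intro h
    simp [h] at hXS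
  -- Strictness here is what admits `ε = 1 / 2`; against the uniform distribution the mass can equal
  -- `1 / 2`, and `ε < 1 / 2` is needed instead.
  have hYS : ∑ x ∈ S, (Y x).toReal < 1 / 2 := by
    calc ∑ x ∈ S, (Y x).toReal < ∑ _x ∈ S, ((2 : ℝ) ^ (k + 1))⁻¹ :=
          Finset.sum_lt_sum_of_nonempty hSne fun x _ => toReal_lt_of_lt_minEntropy hlt x
      _ = S.card * ((2 : ℝ) ^ (k + 1))⁻¹ := by simp
      _ ≤ 2 ^ k * ((2 : ℝ) ^ (k + 1))⁻¹ := by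
          gcongr
          exact_mod_cast hS
      _ = 1 / 2 := by rw [pow_succ]; field_simp
  obtain ⟨D, hD, h⟩ := exists_distinguisher hc hn hS hXS hYS.le hε (by linarith)
  have h' := hY D hD
  rw [abs_sub_comm] at h'
  exact absurd (h.trans_le (le_abs_self _)) (not_lt.2 h')

theorem support_map_unif_subset {k : ℕ} (f : (Fin k → Bool) → (Fin n → Bool)) :
    ((unif k).map f).support ⊆ Set.range f := by
  rw [PMF.support_map]
  exact Set.image_subset_range _ _

theorem ncard_support_map_unif_le {k : ℕ} (f : (Fin k → Bool) → (Fin n → Bool)) :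
    ((unif k).map f).support.ncard ≤ 2 ^ k := by
  refine (Set.ncard_le_ncard (support_map_unif_subset f)).trans ?_
  rw [← Set.image_univ]
  refine (Set.ncard_image_le Set.finite_univ).trans ?_
  simp

theorem exists_distinguisher_unif {c : ℝ} (hc : 0 < c) {k : ℕ}
    (f : (Fin k → Bool) → (Fin (k + 1) → Bool)) {ε : ℝ}
    (hε : c * (2 : ℝ) ^ (-(k : ℝ) / 2) ≤ ε) (hε' : ε < 1 / 2) :
    ∃ D : Circuit (k + 1),
      (D.size : ℝ) ≤ sizeConst c * ((k + 1 : ℕ) : ℝ) * (2 ^ k * ε ^ 2) ∧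
        ε < |accProb D ((unif k).map f) - accProb D (unif (k + 1))| := by
  classical
  set X := (unif k).map f with hXdef
  set S := X.support.toFinset with hSdef
  have hS : S.card ≤ 2 ^ k := by
    rw [hSdef, ← Set.ncard_eq_toFinset_card']
    exact ncard_support_map_unif_le f
  have hXS : ∑ x ∈ S, (X x).toReal = 1 := sum_support_toReal X
  have hYS : ∑ x ∈ S, (unif (k + 1) x).toReal ≤ 1 / 2 := by
    calc ∑ x ∈ S, (unif (k + 1) x).toReal = S.card * ((2 : ℝ) ^ (k + 1))⁻¹ := by simp [unif]
      _ ≤ 2 ^ k * ((2 : ℝ) ^ (k + 1))⁻¹ := by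
          gcongr
          exact_mod_cast hS
      _ = 1 / 2 := by rw [pow_succ]; field_simp
  obtain ⟨D, hD, h⟩ := exists_distinguisher hc (by omega) hS hXS hYS hε (by linarith)
  exact ⟨D, hD, h.trans_le (le_abs_self _)⟩

end Distinguishers

end Pseudoentropy

theorem theorem1 (c : ℝ) (hc : 0 < c) :
    ∃ C : ℝ, 0 < C ∧
      (∀ (n k : ℕ) (f : (Fin k → Bool) → (Fin n → Bool)) (ε : ℝ),
        c * (2 : ℝ) ^ (-(k : ℝ) / 2) ≤ ε → ε ≤ 1 / 2 →
          Pseudoentropy.hill (C * n * (2 ^ k * ε ^ 2)) ε ((Pseudoentropy.unif k).map f)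
            ≤ (k : ℝ) + 1) ∧
      (∀ (n k : ℕ) (X : PMF (Fin n → Bool)), X.support.ncard ≤ 2 ^ k → ∀ ε : ℝ,
        c * (2 : ℝ) ^ (-(k : ℝ) / 2) ≤ ε → ε ≤ 1 / 2 →
          Pseudoentropy.hill (C * n * (2 ^ k * ε ^ 2)) ε X ≤ (k : ℝ) + 1) ∧
      (∀ (k : ℕ) (f : (Fin k → Bool) → (Fin (k + 1) → Bool)) (ε : ℝ),
        c * (2 : ℝ) ^ (-(k : ℝ) / 2) ≤ ε → ε < 1 / 2 →
          ∃ D : Pseudoentropy.Circuit (k + 1),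
            (D.size : ℝ) ≤ C * ((k + 1 : ℕ) : ℝ) * (2 ^ k * ε ^ 2) ∧
              ε < |Pseudoentropy.accProb D ((Pseudoentropy.unif k).map f) -
                Pseudoentropy.accProb D (Pseudoentropy.unif (k + 1))|) := by
  exact ⟨Pseudoentropy.sizeConst c, Pseudoentropy.sizeConst_pos hc,
    fun _ _ f _ hε hε' => Pseudoentropy.hill_le_of_card_support hc
      (Pseudoentropy.ncard_support_map_unif_le f) hε hε',
    fun _ _ _ hX _ hε hε' => Pseudoentropy.hill_le_of_card_support hc hX hε hε',
    fun _ f _ hε hε' => Pseudoentropy.exists_distinguisher_unif hc f hε hε'⟩
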